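/- All graphs are finite and simple. A $k$-queue layout of a graph $G$ consists of a linear ordering $\preceq$ of $V(G)$ and a partition of $E(G)$ into $k$ (possibly empty) sets such that no two edges in the same set are nested, where edges $vw$ and $xy$ are nested if $v\prec x\prec y\prec w$. The queue-number of $G$ is the minimum $k$ such that $G$ has a $k$-queue layout. The Euler genus of $G$ is the minimum integer $g\geq 0$ such that $G$ embeds in the orientable surface with $g/2$ handles (where $g$ is even) or in the non-orientable surface with $g$ cross-caps; $G$ is planar if and only if it has Euler genus $0$. A class of graphs is hereditary if it is closed under taking induced subgraphs. Let $k\geq 0$ be an integer and let $\mathcal{G}$ be a hereditary class of graphs such that every planar graph in $\mathcal{G}$ has queue-number at most $k$. Then, for every integer $g\geq 0$, every graph in $\mathcal{G}$ with Euler genus $g$ has queue-number at most $3k+4g$. -/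

import Mathlib

universe u

/-! ## Queue layouts -/

/-- `G` has a `k`-queue layout: a linear ordering of the vertices and a partition of the edges into
`k` (possibly empty) classes such that no two edges of the same class are nested; edges `vw` and
`xy` are nested if `v < x < y < w`. -/
def SimpleGraph.HasQueueLayout {V : Type u} (G : SimpleGraph V) (k : ℕ) : Prop :=
  ∃ (_ : LinearOrder V) (queue : G.edgeSet → Fin k),
    ∀ (v w x y : V) (hvw : G.Adj v w) (hxy : G.Adj x y), v < x → x < y → y < w →
      queue ⟨s(v, w), hvw⟩ ≠ queue ⟨s(x, y), hxy⟩

/-- The minimum `k` such that `G` has a `k`-queue layout. -/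
noncomputable def SimpleGraph.queueNumber {V : Type u} (G : SimpleGraph V) : ℕ :=
  sInf {k : ℕ | G.HasQueueLayout k}

/-- For a finite graph the minimum is taken over a nonempty set. -/
theorem SimpleGraph.exists_hasQueueLayout {V : Type u} [Finite V] (G : SimpleGraph V) :
    ∃ k, G.HasQueueLayout k := by
  let L : LinearOrder V := LinearOrder.lift' _ (Finite.equivFin V).injective
  refine ⟨Nat.card G.edgeSet, L, Finite.equivFin G.edgeSet, ?_⟩
  intro v w x y hvw hxy h1 h2 h3 h
  have h4 := congrArg Subtype.val ((Finite.equivFin G.edgeSet).injective h)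
  have h5 : v = x ∨ v = y := by
    rcases Sym2.eq_iff.1 h4 with h | h
    · exact Or.inl h.1
    · exact Or.inr h.1
  rcases h5 with rfl | rfl
  · exact lt_irrefl _ h1
  · exact lt_irrefl _ (h1.trans h2)

/-! ## Embeddings of graphs in closed surfaces -/

/-- An embedding scheme of `G`, consisting of a rotation system and a signature: `rot` permutes
cyclically the darts (oriented edges) that leave each vertex, and every edge carries a sign,
which is `1` if the local orientations at its two ends agree along the edge, and `-1` otherwise.
For a connected graph, the embedding schemes are the cellular embeddings in closed surfaces,
orientable or not. For a general graph, each component is cellularly embedded in a closed surface of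
its own, and `G` is embedded in the connected sum of these surfaces. -/
structure SimpleGraph.EmbeddingScheme {V : Type u} (G : SimpleGraph V) where
  /-- the dart that follows a given dart in the rotation at its initial vertex -/
  rot : Equiv.Perm G.Dart
  rot_fst : ∀ d, (rot d).fst = d.fst
  rot_sameCycle : ∀ d d' : G.Dart, d.fst = d'.fst → rot.SameCycle d d'
  /-- the signature -/
  sign : G.edgeSet → ℤˣ

namespace SimpleGraph.EmbeddingScheme

variable {V : Type u} {G : SimpleGraph V}

/-- The pair `(d, 1)` stands for the side of the dart `d` towards the next dart `rot d`, and
`(d, -1)` for its other side; sides are taken near the initial vertex of `d`. Walking along the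
boundary of a face one passes through a corner from `d` to `rot d`, and along an edge from one end
to the other. Along an edge of sign `1`, the side of `d` towards `rot d` is the side of
the reversed dart away from its successor. -/
inductive FaceStep (S : G.EmbeddingScheme) : G.Dart × ℤˣ → G.Dart × ℤˣ → Prop
  | corner (d : G.Dart) : FaceStep S (d, 1) (S.rot d, -1)
  | edge (d : G.Dart) (s : ℤˣ) : FaceStep S (d, s) (d.symm, -(S.sign ⟨d.edge, d.edge_mem⟩ * s))

/-- The facial walks (up to reversal) of an embedding scheme, each of them regarded as the set of
sides of darts that it runs along. -/
def FacialWalk (S : G.EmbeddingScheme) : Type u :=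
  Quot S.FaceStep

/-- The number of faces, where each component is embedded in its own surface. A component that
consists of an isolated vertex has no dart, and one face (in the sphere). -/
noncomputable def numFaces (S : G.EmbeddingScheme) : ℕ :=
  Nat.card S.FacialWalk + Nat.card {v : V // ∀ w, ¬ G.Adj v w}

/-- The Euler genus of the surface by Euler's formula, which is `n - m + f = 2 - g` for each
component; the Euler genus of a connected sum is the sum of the Euler genera. -/
noncomputable def eulerGenus (S : G.EmbeddingScheme) : ℤ :=
  2 * Nat.card G.ConnectedComponent - Nat.card V + Nat.card G.edgeSet - S.numFaces

/-- Every finite graph has an embedding scheme. -/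
instance [Finite V] : Nonempty G.EmbeddingScheme := by
  classical
  have : Finite G.Dart := Finite.of_injective _ SimpleGraph.Dart.toProd_injective
  have h : ∀ v : V, ∃ f : Equiv.Perm {d : G.Dart // d.fst = v}, ∀ x y, f.SameCycle x y := by
    intro v
    have := Fintype.ofFinite {d : G.Dart // d.fst = v}
    obtain ⟨f, hf, -⟩ := Finset.exists_cycleOn (Finset.univ : Finset {d : G.Dart // d.fst = v})
    exact ⟨f, fun x y => hf.2 (by simp) (by simp)⟩
  choose f hf using h
  let e := Equiv.sigmaFiberEquiv (fun d : G.Dart => d.fst)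
  let r : Equiv.Perm (Σ v, {d : G.Dart // d.fst = v}) := Equiv.Perm.sigmaCongrRightHom _ f
  refine ⟨⟨e.permCongrHom r, ?_, ?_, fun _ => 1⟩⟩
  · intro d
    exact (f d.fst ⟨d, rfl⟩).2
  · intro d d' hd
    obtain ⟨i, hi⟩ := hf d'.fst ⟨d, hd⟩ ⟨d', rfl⟩
    refine ⟨i, ?_⟩
    have h1 : e.symm d = ⟨d'.fst, ⟨d, hd⟩⟩ := by
      rw [Equiv.symm_apply_eq]; rfl
    rw [← map_zpow]
    change e ((r ^ i) (e.symm d)) = d'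
    rw [h1]
    change e (((Equiv.Perm.sigmaCongrRightHom _ f) ^ i) _) = d'
    rw [← map_zpow]
    change (((f ^ i) d'.fst) ⟨d, hd⟩).1 = d'
    rw [Pi.pow_apply, hi]

end SimpleGraph.EmbeddingScheme

/-- The Euler genus of a finite graph: the minimum Euler genus of a closed surface, orientable or
not, in which it embeds. (An embedding of minimum Euler genus can be taken to be given by an
embedding scheme. The Euler genus of a scheme is never negative, so that `Int.toNat` only changes
the type.) -/
noncomputable def SimpleGraph.eulerGenus {V : Type u} (G : SimpleGraph V) : ℕ :=
  ⨅ S : G.EmbeddingScheme, S.eulerGenus.toNat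

/-- A graph is planar if it embeds in the sphere. -/
def SimpleGraph.Planar {V : Type u} (G : SimpleGraph V) : Prop :=
  ∃ S : G.EmbeddingScheme, S.eulerGenus = 0

/-! ## Classes of graphs -/

/-- A class of finite graphs. -/
def GraphClass : Type (u + 1) :=
  ∀ (V : Type u) [Finite V], SimpleGraph V → Prop

/-- A class of graphs is hereditary if it is closed under taking induced subgraphs. -/
def GraphClass.Hereditary (𝒢 : GraphClass.{u}) : Prop :=
  ∀ (V : Type u) [Finite V] (G : SimpleGraph V), 𝒢 V G → ∀ A : Set V, 𝒢 A (G.induce A)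

/-!
The argument is homological, with coefficients in the field with two elements.

For an embedding scheme `S` of `G`, send a set of faces to the set of edges that have exactly one
side in it. The image of this map lies in the cycle space of `G`, and by Euler's formula the cycle
space modulo the image has dimension `S.eulerGenus`
(`EmbeddingScheme.eulerGenus_add_finrank_range`). In particular the genus is nonnegative, and a
scheme has genus `0` if and only if every cycle bounds a set of faces.

Take a breadth-first layering of each component, and for each vertex a shortest path from the
root. The cycles that close up an edge by the root paths of its two ends span the cycle space
(`sum_smul_fundamentalCycle`), so that `g` of them span it modulo boundaries of faces, where `g` is
the genus of `S`. Let `Z` be the set of vertices on the `2g` root paths of these `g` cycles. It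
has at most `2g` vertices in each layer (`EmbeddingScheme.exists_layered_generators`).

The graph `G - Z` is planar (`EmbeddingScheme.planar_induce`). Indeed, a cycle of `G - Z` is the
sum of some of the `g` cycles, which live on `Z`, and of the boundary of a set `F` of faces.
No edge between `Z` and its complement is in that boundary, so `F` does not distinguish the faces
that merge when `Z` is deleted. Hence `F` is a set of faces of the induced scheme of `G - Z`, and
the cycle is its boundary.

Finally, a `k`-queue layout of `G - Z` is rearranged layer by layer at the cost of a factor `3`,
and the vertices of `Z`, placed first in their layers, take two queues for each of the `2g` places
(`hasQueueLayout_of_layering`).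
-/

/-! ### First-return permutations -/

/-- The first-return map of a permutation to the range of an injection. -/
theorem Equiv.Perm.exists_firstReturn {α β : Type*} [Finite α] (σ : Equiv.Perm α) (ι : β → α)
    (hι : Function.Injective ι) :
    ∃ τ : Equiv.Perm β,
      (∀ b, ∃ n, ι (τ b) = (σ ^ (n + 1)) (ι b) ∧
        ∀ i < n, (σ ^ (i + 1)) (ι b) ∉ Set.range ι) ∧
      ∀ b b', σ.SameCycle (ι b) (ι b') → τ.SameCycle b b' := by
  classical
  have : Finite β := Finite.of_injective ι hι
  have hex : ∀ b, ∃ n, (σ ^ (n + 1)) (ι b) ∈ Set.range ι := fun b =>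
    ⟨orderOf σ - 1, by
      rw [Nat.sub_add_cancel (isOfFinOrder_of_finite σ).orderOf_pos, pow_orderOf_eq_one]
      exact ⟨b, rfl⟩⟩
  choose f hf using fun b => Nat.find_spec (hex b)
  have hmin : ∀ b i, i < Nat.find (hex b) → (σ ^ (i + 1)) (ι b) ∉ Set.range ι :=
    fun b i hi => Nat.find_min (hex b) hi
  have hinj : Function.Injective f := by
    suffices h : ∀ b b', f b = f b' → Nat.find (hex b) ≤ Nat.find (hex b') → b = b' by
      intro b b' hb
      rcases le_total (Nat.find (hex b)) (Nat.find (hex b')) with h1 | h1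
      · exact h b b' hb h1
      · exact (h b' b hb.symm h1).symm
    intro b b' hb hle
    have h1 := hf b
    rw [hb, hf b'] at h1
    obtain ⟨j, hj⟩ := Nat.exists_eq_add_of_le hle
    rw [hj, show Nat.find (hex b) + j + 1 = (Nat.find (hex b) + 1) + j by omega, pow_add,
      Equiv.Perm.mul_apply] at h1
    have h2 := (σ ^ (Nat.find (hex b) + 1)).injective h1
    -- if the return times differ, then the later start meets the range at `ι b` before its return
    rcases j with _ | j
    · exact hι h2.symm
    · exact absurd ⟨b, h2.symm⟩ (hmin b' j (by omega))
  refine ⟨Equiv.ofBijective f (Finite.injective_iff_bijective.1 hinj),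
    fun b => ⟨Nat.find (hex b), hf b, hmin b⟩, ?_⟩
  intro b b' h
  obtain ⟨n, hn⟩ := h.exists_nat_pow_eq
  clear h
  induction n using Nat.strong_induction_on generalizing b with
  | _ n ih =>
    rcases n with _ | n
    · rw [hι hn]
    · have hle : Nat.find (hex b) ≤ n := Nat.find_min' _ ⟨b', hn.symm⟩
      refine Equiv.Perm.SameCycle.trans (y := f b) ⟨1, rfl⟩
        (ih (n - Nat.find (hex b)) (by omega) _ ?_)
      rw [hf b, ← Equiv.Perm.mul_apply, ← pow_add, ← hn]
      congr 2
      omega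

namespace SimpleGraph

open scoped Classical

noncomputable section

/-! ### Chains modulo 2 -/

section Chains

variable {V : Type u} [Fintype V] (G : SimpleGraph V)

/-- The vertex-edge incidence matrix over the field with two elements. -/
def incidenceTwo : Matrix V G.edgeSet (ZMod 2) :=
  fun v e => if v ∈ e.1 then 1 else 0

/-- The boundary map from 1-chains to 0-chains, with coefficients modulo 2. -/
def boundaryMap : (G.edgeSet → ZMod 2) →ₗ[ZMod 2] (V → ZMod 2) :=
  G.incidenceTwo.mulVecLin

/-- The coboundary map, which sends a function on the vertices to its sums along edges. -/
def coboundaryMap : (V → ZMod 2) →ₗ[ZMod 2] (G.edgeSet → ZMod 2) :=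
  G.incidenceTwo.transpose.mulVecLin

/-- The cycle space modulo 2. -/
def cycleSpace : Submodule (ZMod 2) (G.edgeSet → ZMod 2) :=
  LinearMap.ker G.boundaryMap

variable {G}

theorem boundaryMap_apply (a : G.edgeSet → ZMod 2) (v : V) :
    G.boundaryMap a v = ∑ e, G.incidenceTwo v e * a e := rfl

theorem sum_incidenceTwo_smul {M : Type*} [AddCommGroup M] [Module (ZMod 2) M] (f : V → M)
    {u v : V} (h : G.Adj u v) :
    ∑ w, G.incidenceTwo w ⟨s(u, v), h⟩ • f w = f u + f v := by
  have : ∀ w, G.incidenceTwo w ⟨s(u, v), h⟩ • f w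
      = (if w = u then f w else 0) + (if w = v then f w else 0) := by
    intro w
    have := h.ne
    by_cases h1 : w = u <;> by_cases h2 : w = v <;> simp_all [incidenceTwo]
  simp [this, Finset.sum_add_distrib]

theorem coboundaryMap_apply (f : V → ZMod 2) {u v : V} (h : G.Adj u v) :
    G.coboundaryMap f ⟨s(u, v), h⟩ = f u + f v :=
  sum_incidenceTwo_smul f h

theorem boundaryMap_single {u v : V} (h : G.Adj u v) :
    G.boundaryMap (Pi.single ⟨s(u, v), h⟩ 1) = Pi.single u 1 + Pi.single v 1 := by
  ext w
  rw [← sum_incidenceTwo_smul (fun x => (Pi.single x 1 : V → ZMod 2)) h, boundaryMap_apply]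
  simp [Pi.single_apply]

theorem add_self_eq_zero_of_zmod_two {M : Type*} [AddCommGroup M] [Module (ZMod 2) M] (x : M) :
    x + x = 0 := by
  rw [← two_smul (ZMod 2) x, show (2 : ZMod 2) = 0 from rfl, zero_smul]

theorem zmod_two_add_eq_zero_iff {x y : ZMod 2} : x + y = 0 ↔ x = y := by
  revert x y; decide

theorem finrank_range_funLeft {X Y : Type*} [Finite X] [Finite Y] (κ : X → Y)
    (hκ : Function.Surjective κ) :
    Module.finrank (ZMod 2) (LinearMap.range (LinearMap.funLeft (ZMod 2) (ZMod 2) κ))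
      = Nat.card Y := by
  have := Fintype.ofFinite Y
  rw [LinearMap.finrank_range_of_inj (LinearMap.funLeft_injective_of_surjective _ _ _ hκ),
    Module.finrank_fintype_fun_eq_card, Nat.card_eq_fintype_card]

theorem ker_coboundaryMap :
    LinearMap.ker G.coboundaryMap
      = LinearMap.range (LinearMap.funLeft (ZMod 2) (ZMod 2) G.connectedComponentMk) := by
  ext f
  rw [LinearMap.mem_ker, LinearMap.mem_range]
  constructor
  · intro hf
    have hadj : ∀ u v, G.Adj u v → f u = f v := fun u v h => by
      have := congrFun hf ⟨s(u, v), h⟩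
      rw [coboundaryMap_apply] at this
      exact zmod_two_add_eq_zero_iff.1 this
    refine ⟨ConnectedComponent.lift f ?_, rfl⟩
    intro u v p _
    induction p with
    | nil => rfl
    | cons h _ ih => exact (hadj _ _ h).trans (ih (by rename_i hp; exact hp.of_cons))
  · rintro ⟨g, rfl⟩
    ext ⟨e, he⟩
    induction e with
    | _ u v =>
      rw [coboundaryMap_apply _ he]
      simp [LinearMap.funLeft_apply,
        ConnectedComponent.sound (show G.Adj u v from he).reachable, CharTwo.add_self_eq_zero]

/-- The dimension of the cycle space is `m - n + c`. -/
theorem finrank_cycleSpace :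
    Module.finrank (ZMod 2) G.cycleSpace + Nat.card V
      = Nat.card G.edgeSet + Nat.card G.ConnectedComponent := by
  have h1 := G.boundaryMap.finrank_range_add_finrank_ker
  have h2 := G.coboundaryMap.finrank_range_add_finrank_ker
  have h3 : Module.finrank (ZMod 2) (LinearMap.range G.coboundaryMap)
      = Module.finrank (ZMod 2) (LinearMap.range G.boundaryMap) :=
    G.incidenceTwo.rank_transpose
  rw [ker_coboundaryMap, finrank_range_funLeft G.connectedComponentMk Quot.mk_surjective] at h2
  rw [Module.finrank_fintype_fun_eq_card, ← Nat.card_eq_fintype_card] at h1 h2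
  unfold cycleSpace
  omega

end Chains

/-! ### Boundaries of sets of faces and the Euler genus -/

namespace EmbeddingScheme

variable {V : Type u} {G : SimpleGraph V}

theorem exists_dart_edge_eq (e : G.edgeSet) : ∃ d : G.Dart, d.edge = e := by
  obtain ⟨e, he⟩ := e
  induction e with
  | _ u v => exact ⟨⟨(u, v), he⟩, rfl⟩

/-- The map that sends a set of faces (as a function to the field with two elements) to its
boundary: an edge counts if exactly one of its two sides lies in the set. The sides are read off
at an arbitrary one of the two darts of the edge. -/
def faceBoundary (S : G.EmbeddingScheme) :
    (S.FacialWalk → ZMod 2) →ₗ[ZMod 2] (G.edgeSet → ZMod 2) where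
  toFun F e := F (Quot.mk _ ((exists_dart_edge_eq e).choose, 1))
    + F (Quot.mk _ ((exists_dart_edge_eq e).choose, -1))
  map_add' _ _ := funext fun _ => add_add_add_comm _ _ _ _
  map_smul' _ _ := funext fun _ => (mul_add _ _ _).symm

variable (S : G.EmbeddingScheme)

theorem faceBoundary_apply (F : S.FacialWalk → ZMod 2) (d : G.Dart) :
    S.faceBoundary F ⟨d.edge, d.edge_mem⟩
      = F (Quot.mk _ (d, 1)) + F (Quot.mk _ (d, -1)) := by
  have key : ∀ d' : G.Dart, d'.edge = d.edge →
      F (Quot.mk _ (d', 1)) + F (Quot.mk _ (d', -1))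
        = F (Quot.mk _ (d, 1)) + F (Quot.mk _ (d, -1)) := by
    intro d' h
    rcases (dart_edge_eq_iff d' d).1 h with rfl | rfl
    · rfl
    · have h1 := Quot.sound (FaceStep.edge (S := S) d 1)
      have h2 := Quot.sound (FaceStep.edge (S := S) d (-1))
      rw [h1, h2]
      rcases Int.units_eq_one_or (S.sign ⟨d.edge, d.edge_mem⟩) with h | h <;> simp [h, add_comm]
  exact key _ (exists_dart_edge_eq ⟨d.edge, d.edge_mem⟩).choose_spec

theorem corner_eq (F : S.FacialWalk → ZMod 2) (d : G.Dart) :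
    F (Quot.mk _ (S.rot d, -1)) = F (Quot.mk _ (d, 1)) :=
  congrArg F (Quot.sound (FaceStep.corner d)).symm

variable [Fintype V]

/-- Summing over the darts at a vertex turns a sum over the edges at that vertex into a sum over
corners, each of which is counted twice. -/
theorem range_faceBoundary_le : LinearMap.range S.faceBoundary ≤ G.cycleSpace := by
  rintro _ ⟨F, rfl⟩
  rw [cycleSpace, LinearMap.mem_ker]
  ext v
  rw [boundaryMap_apply]
  have h1 : ∑ e, G.incidenceTwo v e * S.faceBoundary F e
      = ∑ d : G.Dart, if d.fst = v then S.faceBoundary F ⟨d.edge, d.edge_mem⟩ else 0 := by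
    rw [← Finset.sum_filter]
    simp only [incidenceTwo, ite_mul, one_mul, zero_mul]
    rw [← Finset.sum_filter]
    symm
    refine Finset.sum_bij (fun d _ => ⟨d.edge, d.edge_mem⟩) ?_ ?_ ?_ ?_
    · intro d hd
      simp only [Finset.mem_filter, Finset.mem_univ, true_and] at hd ⊢
      rw [← hd]
      exact Sym2.mem_mk_left _ _
    · intro d hd d' hd' h
      simp only [Finset.mem_filter, Finset.mem_univ, true_and] at hd hd'
      rcases (dart_edge_eq_iff d d').1 (congrArg Subtype.val h) with h | h
      · exact h
      · exfalso
        rw [h] at hd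
        exact d'.fst_ne_snd (hd'.trans hd.symm)
    · rintro ⟨e, he⟩ hv
      simp only [Finset.mem_filter, Finset.mem_univ, true_and] at hv
      obtain ⟨w, rfl⟩ := hv
      exact ⟨⟨(v, w), he⟩, by simp, rfl⟩
    · intro d _
      rfl
  have h2 : ∑ d : G.Dart, (if d.fst = v then F (Quot.mk _ (d, -1)) else 0)
      = ∑ d : G.Dart, (if d.fst = v then F (Quot.mk _ (d, 1)) else 0) := by
    rw [← Equiv.sum_comp S.rot]
    simp only [S.rot_fst, S.corner_eq]
  rw [h1]
  simp only [faceBoundary_apply, ite_add_zero, Finset.sum_add_distrib, h2]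
  exact zmod_two_add_eq_zero_iff.2 rfl

/-- The component of `G` in whose surface a face lies; the faces are the facial walks and the
isolated vertices. -/
def faceComponent : S.FacialWalk ⊕ {v : V // ∀ w, ¬ G.Adj v w} → G.ConnectedComponent :=
  Sum.elim
    (Quot.lift (fun x => G.connectedComponentMk x.1.fst) (by
      rintro _ _ (d | ⟨d, s⟩)
      · simp [S.rot_fst]
      · exact ConnectedComponent.sound d.adj.reachable))
    (fun v => G.connectedComponentMk v.1)

theorem faceComponent_surjective : Function.Surjective S.faceComponent := by
  intro c
  induction c using ConnectedComponent.ind with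
  | _ v =>
    by_cases h : ∀ w, ¬ G.Adj v w
    · exact ⟨Sum.inr ⟨v, h⟩, rfl⟩
    · push Not at h
      obtain ⟨w, hw⟩ := h
      exact ⟨Sum.inl (Quot.mk _ (⟨(v, w), hw⟩, 1)), rfl⟩

/-- A set of faces without boundary is a union of whole surfaces. -/
theorem ker_faceBoundary_comp :
    LinearMap.ker (S.faceBoundary ∘ₗ LinearMap.funLeft (ZMod 2) (ZMod 2) Sum.inl)
      = LinearMap.range (LinearMap.funLeft (ZMod 2) (ZMod 2) S.faceComponent) := by
  ext F
  rw [LinearMap.mem_ker, LinearMap.mem_range]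
  constructor
  · intro hF
    have hside : ∀ d : G.Dart, F (Sum.inl (Quot.mk _ (d, 1))) = F (Sum.inl (Quot.mk _ (d, -1))) :=
      fun d => by
        have := congrFun hF ⟨d.edge, d.edge_mem⟩
        rw [LinearMap.comp_apply, faceBoundary_apply] at this
        exact zmod_two_add_eq_zero_iff.1 this
    have hside' : ∀ (d : G.Dart) (s : ℤˣ),
        F (Sum.inl (Quot.mk _ (d, s))) = F (Sum.inl (Quot.mk _ (d, 1))) := by
      intro d s
      rcases Int.units_eq_one_or s with rfl | rfl
      · rfl
      · exact (hside d).symm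
    have hrot : ∀ d : G.Dart,
        F (Sum.inl (Quot.mk _ (S.rot d, 1))) = F (Sum.inl (Quot.mk _ (d, 1))) := fun d => by
      rw [hside]
      exact S.corner_eq (F ∘ Sum.inl) d
    have hzpow : ∀ (n : ℕ) (d : G.Dart),
        F (Sum.inl (Quot.mk _ ((S.rot ^ n) d, 1))) = F (Sum.inl (Quot.mk _ (d, 1))) := by
      intro n
      induction n with
      | zero => intro d; rfl
      | succ n ih => intro d; rw [pow_succ', Equiv.Perm.mul_apply, hrot, ih]
    have hvert : ∀ d d' : G.Dart, d.fst = d'.fst →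
        F (Sum.inl (Quot.mk _ (d, 1))) = F (Sum.inl (Quot.mk _ (d', 1))) := by
      intro d d' h
      obtain ⟨n, hn⟩ := (S.rot_sameCycle d d' h).exists_nat_pow_eq
      rw [← hn, hzpow]
    let f : V → ZMod 2 := fun v =>
      if h : ∀ w, ¬ G.Adj v w then F (Sum.inr ⟨v, h⟩)
      else F (Sum.inl (Quot.mk _ (⟨(v, (not_forall_not.1 h).choose),
        (not_forall_not.1 h).choose_spec⟩, 1)))
    have hf : ∀ d : G.Dart, f d.fst = F (Sum.inl (Quot.mk _ (d, 1))) := by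
      intro d
      have : ¬ ∀ w, ¬ G.Adj d.fst w := fun h => h _ d.adj
      simp only [f, dif_neg this]
      exact hvert _ _ rfl
    have hker : f ∈ LinearMap.ker G.coboundaryMap := by
      rw [LinearMap.mem_ker]
      ext ⟨e, he⟩
      induction e with
      | _ u v =>
        rw [coboundaryMap_apply _ he]
        let d : G.Dart := ⟨(u, v), he⟩
        refine zmod_two_add_eq_zero_iff.2 ((hf d).trans (Eq.trans ?_ (hf d.symm).symm))
        have := Quot.sound (FaceStep.edge (S := S) d 1)
        exact (congrArg (F ∘ Sum.inl) this).trans (hside' _ _)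
    rw [ker_coboundaryMap, LinearMap.mem_range] at hker
    obtain ⟨g, hg⟩ := hker
    refine ⟨g, ?_⟩
    ext x
    rcases x with ⟨d, s⟩ | v
    · exact ((congrFun hg d.fst).trans (hf d)).trans (hside' d s).symm
    · refine (congrFun hg v.1).trans ?_
      simp [f, v.2]
  · rintro ⟨g, rfl⟩
    ext e
    obtain ⟨d, hd⟩ := exists_dart_edge_eq e
    obtain rfl : e = ⟨d.edge, d.edge_mem⟩ := Subtype.ext hd.symm
    rw [LinearMap.comp_apply, faceBoundary_apply]
    exact CharTwo.add_self_eq_zero _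

instance : Finite S.FacialWalk := Quot.finite _

/-- The Euler genus of a scheme is the dimension of the first homology group modulo 2. -/
theorem eulerGenus_add_finrank_range :
    S.eulerGenus + Module.finrank (ZMod 2) (LinearMap.range S.faceBoundary)
      = Module.finrank (ZMod 2) G.cycleSpace := by
  have := Fintype.ofFinite S.FacialWalk
  have h1 := (S.faceBoundary ∘ₗ LinearMap.funLeft (ZMod 2) (ZMod 2)
    (Sum.inl (β := {v : V // ∀ w, ¬ G.Adj v w}))).finrank_range_add_finrank_ker
  rw [ker_faceBoundary_comp, finrank_range_funLeft _ S.faceComponent_surjective,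
    LinearMap.range_comp_of_range_eq_top _ (LinearMap.range_eq_top.2
      (LinearMap.funLeft_surjective_of_injective _ _ _ Sum.inl_injective)),
    Module.finrank_fintype_fun_eq_card, ← Nat.card_eq_fintype_card, Nat.card_sum] at h1
  have h2 := G.finrank_cycleSpace
  unfold eulerGenus numFaces
  omega

end EmbeddingScheme

/-! ### Layerings and generators of the cycle space -/

section Layering

variable {V : Type u}

/-- A layering of `G` with the properties of the distances to a root of each component that the
argument uses: every vertex other than its root has a neighbour one layer below, and edges join vertices of the same or consecutive layers. -/
structure BFSLayering (G : SimpleGraph V) where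
  /-- the layer of a vertex -/
  layer : V → ℕ
  /-- the root of the component of a vertex -/
  root : V → V
  root_eq : ∀ {u v}, G.Adj u v → root u = root v
  layer_le : ∀ {u v}, G.Adj u v → layer v ≤ layer u + 1
  exists_parent : ∀ v, v = root v ∨ ∃ u, G.Adj u v ∧ layer v = layer u + 1

theorem nonempty_bfsLayering (G : SimpleGraph V) : Nonempty G.BFSLayering := by
  let r : V → V := fun v => Quot.out (G.connectedComponentMk v)
  have hr : ∀ v, G.Reachable (r v) v := fun v =>
    ConnectedComponent.exact (Quot.out_eq (G.connectedComponentMk v))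
  have hadj : ∀ {u v}, G.Adj u v → r u = r v := fun h =>
    congrArg Quot.out (ConnectedComponent.sound h.reachable)
  refine ⟨⟨fun v => G.dist (r v) v, r, hadj, ?_, ?_⟩⟩
  · intro u v h
    rw [hadj h]
    have := h.diff_dist_adj (u := r v)
    omega
  · intro v
    have key : ∀ (x : V) (p : G.Walk v x), p.length = G.dist v x →
        v = x ∨ ∃ u, G.Adj u v ∧ G.dist x v = G.dist x u + 1 := by
      intro x p hp
      cases p with
      | nil => exact Or.inl rfl
      | @cons _ u _ h q =>
        refine Or.inr ⟨u, h.symm, ?_⟩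
        rw [Walk.length_cons, dist_comm] at hp
        have h1 := dist_le q
        rw [dist_comm] at h1
        have h2 := h.symm.diff_dist_adj (u := x)
        omega
    obtain ⟨p, hp⟩ := (hr v).symm.exists_walk_length_eq_dist
    refine (key _ p hp).imp_right fun ⟨u, hu, h⟩ => ⟨u, hu, ?_⟩
    rw [hadj hu]
    exact h

variable [Fintype V] {G : SimpleGraph V}

/-- A shortest path from the root to `v`, given by its set of vertices `R` and its sum of
edges `P`. -/
theorem BFSLayering.exists_rootPath (L : G.BFSLayering) (v : V) :
    ∃ (R : Set V) (P : G.edgeSet → ZMod 2), v ∈ R ∧ (∀ u ∈ R, L.layer u ≤ L.layer v) ∧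
      Set.InjOn L.layer R ∧ (∀ e, P e ≠ 0 → ∀ w ∈ e.1, w ∈ R) ∧
      G.boundaryMap P = Pi.single v 1 + Pi.single (L.root v) 1 := by
  induction hn : L.layer v using Nat.strong_induction_on generalizing v with
  | _ n ih =>
    subst hn
    rcases L.exists_parent v with h | ⟨u, hu, hl⟩
    · refine ⟨{v}, 0, rfl, ?_, Set.injOn_singleton _ _, ?_, ?_⟩
      · rintro _ rfl
        rfl
      · intro e he
        exact absurd rfl he
      · rw [← h, map_zero, add_self_eq_zero_of_zmod_two]
    · obtain ⟨R, P, h1, h2, h3, h4, h5⟩ := ih (L.layer u) (by omega) u rfl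
      refine ⟨insert v R, P + Pi.single ⟨s(u, v), hu⟩ 1, Set.mem_insert _ _, ?_, ?_, ?_, ?_⟩
      · rintro w (rfl | hw)
        · rfl
        · have := h2 w hw
          omega
      · rw [Set.injOn_insert]
        · refine ⟨h3, ?_⟩
          rintro ⟨w, hw, h⟩
          have := h2 w hw
          omega
        · intro h
          have := h2 v h
          omega
      · intro e he w hw
        by_cases hP : P e = 0
        · have : e = ⟨s(u, v), hu⟩ := by
            by_contra hne
            exact he (by simp [hP, hne])
          subst this
          rcases Sym2.mem_iff.1 hw with rfl | rfl
          · exact Or.inr h1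
          · exact Or.inl rfl
        · exact Or.inr (h4 e hP w hw)
      · rw [map_add, h5, boundaryMap_single, L.root_eq hu]
        have := add_self_eq_zero_of_zmod_two (Pi.single u 1 : V → ZMod 2)
        linear_combination this

/-- If `P v` is a chain from a root to `v` for every `v`, then the cycle space is spanned by the
cycles that arise by closing up an edge `uv` with `P u` and `P v`: a cycle `a` equals
`∑ e, a e • (e + P u + P v)`, since the coefficient of `P v` in this sum is the boundary of `a`
at `v`. -/
theorem sum_smul_fundamentalCycle (P : V → G.edgeSet → ZMod 2) {a : G.edgeSet → ZMod 2}
    (ha : a ∈ G.cycleSpace) :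
    ∑ e, a e • (Pi.single e 1 + ∑ v, G.incidenceTwo v e • P v) = a := by
  have h1 : ∑ e, a e • (Pi.single e 1 : G.edgeSet → ZMod 2) = a := by
    ext e
    simp [Finset.sum_apply, Pi.single_apply]
  have h2 : ∑ e, a e • ∑ v, G.incidenceTwo v e • P v = 0 := by
    simp only [Finset.smul_sum, smul_smul]
    rw [Finset.sum_comm]
    refine Finset.sum_eq_zero fun v _ => ?_
    rw [← Finset.sum_smul]
    have : ∑ e, a e * G.incidenceTwo v e = G.boundaryMap a v := by
      rw [boundaryMap_apply]
      exact Finset.sum_congr rfl fun _ _ => mul_comm _ _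
    rw [this, LinearMap.mem_ker.1 ha, Pi.zero_apply, zero_smul]
  simp only [smul_add, Finset.sum_add_distrib, h1, h2, add_zero]

/-- There is a set `Z` that meets each layer in at most `2g` vertices, and such that every cycle
is, modulo boundaries of faces, a chain on `Z`. Indeed, the cycle space modulo the boundaries has
dimension `g`, so that it is generated by `g` of the cycles that close up an edge by two root
paths. -/
theorem EmbeddingScheme.exists_layered_generators (S : G.EmbeddingScheme) (L : G.BFSLayering) :
    ∃ Z : Set V, (∀ n, {v ∈ Z | L.layer v = n}.ncard ≤ 2 * S.eulerGenus.toNat) ∧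
      ∀ a ∈ G.cycleSpace, ∃ F : S.FacialWalk → ZMod 2,
        ∀ e, (∃ w ∈ e.1, w ∉ Z) → a e = S.faceBoundary F e := by
  choose R P hR1 _ hR3 hP1 hP2 using L.exists_rootPath
  let C : G.edgeSet → G.edgeSet → ZMod 2 :=
    fun e => Pi.single e 1 + ∑ v, G.incidenceTwo v e • P v
  have hC : ∀ e, C e ∈ G.cycleSpace := by
    rintro ⟨e, he⟩
    induction e with
    | _ u v =>
      have he : G.Adj u v := he
      rw [cycleSpace, LinearMap.mem_ker]
      simp only [C]
      rw [sum_incidenceTwo_smul _ he, map_add, map_add, boundaryMap_single he, hP2, hP2,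
        L.root_eq he]
      have h1 := add_self_eq_zero_of_zmod_two (Pi.single u 1 : V → ZMod 2)
      have h2 := add_self_eq_zero_of_zmod_two (Pi.single v 1 : V → ZMod 2)
      have h3 := add_self_eq_zero_of_zmod_two (Pi.single (L.root v) 1 : V → ZMod 2)
      linear_combination h1 + h2 + h3
  have hspan : Submodule.span (ZMod 2) (Set.range C) = G.cycleSpace := by
    refine le_antisymm (Submodule.span_le.2 ?_) ?_
    · rintro _ ⟨e, rfl⟩
      exact hC e
    · intro a ha
      rw [← sum_smul_fundamentalCycle P ha]
      exact Submodule.sum_mem _ fun e _ => Submodule.smul_mem _ _ (Submodule.subset_span ⟨e, rfl⟩)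
  let B := LinearMap.range S.faceBoundary
  obtain ⟨κ, x, hx, hsp, hli⟩ := exists_linearIndependent' (ZMod 2) (B.mkQ ∘ C)
  have : Finite κ := Finite.of_injective x hx
  have := Fintype.ofFinite κ
  have hsp' : Submodule.span (ZMod 2) (Set.range ((B.mkQ ∘ C) ∘ x)) = G.cycleSpace.map B.mkQ := by
    rw [hsp, Set.range_comp, Submodule.span_image, hspan]
  have hcard : Fintype.card κ ≤ S.eulerGenus.toNat := by
    have h1 : Module.finrank (ZMod 2) (G.cycleSpace.map B.mkQ) = Fintype.card κ := by
      rw [← hsp']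
      exact finrank_span_eq_card hli
    have h2 : Module.finrank (ZMod 2) (G.cycleSpace.map B.mkQ)
        + Module.finrank (ZMod 2) (B.submoduleOf G.cycleSpace)
          = Module.finrank (ZMod 2) G.cycleSpace := by
      have := (B.mkQ.domRestrict G.cycleSpace).finrank_range_add_finrank_ker
      rwa [LinearMap.range_domRestrict, LinearMap.ker_domRestrict, Submodule.ker_mkQ] at this
    have h3 : Module.finrank (ZMod 2) (B.submoduleOf G.cycleSpace) = Module.finrank (ZMod 2) B :=
      (Submodule.submoduleOfEquivOfLe S.range_faceBoundary_le).finrank_eq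
    have h4 : S.eulerGenus + Module.finrank (ZMod 2) B = Module.finrank (ZMod 2) G.cycleSpace :=
      S.eulerGenus_add_finrank_range
    omega
  let Z : Set V := {w | ∃ i, ∃ v ∈ (x i).1, w ∈ R v}
  have hCZ : ∀ i e, (∃ w ∈ e.1, w ∉ Z) → C (x i) e = 0 := by
    rintro i e ⟨w, hw, hwZ⟩
    have hne : e ≠ x i := by
      rintro rfl
      exact hwZ ⟨i, w, hw, hR1 w⟩
    simp only [C, Pi.add_apply, Pi.single_apply, if_neg hne, zero_add, Finset.sum_apply,
      Pi.smul_apply]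
    refine Finset.sum_eq_zero fun v _ => ?_
    by_cases hv : v ∈ (x i).1
    · have : P v e = 0 := by
        by_contra h
        exact hwZ ⟨i, v, hv, hP1 v e h w hw⟩
      rw [this, smul_zero]
    · simp [incidenceTwo, hv]
  refine ⟨Z, ?_, ?_⟩
  · intro n
    -- a vertex of `Z` on layer `n` lies on a root path from one of the two ends of some `x i`
    let f : {v ∈ Z | L.layer v = n} → κ × Fin 2 := fun w =>
      (w.2.1.choose, if w.2.1.choose_spec.choose = (Quot.out (x w.2.1.choose).1).1 then 0 else 1)
    have hf : Function.Injective f := by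
      intro w w' h
      have hi : w.2.1.choose = w'.2.1.choose := congrArg Prod.fst h
      have h2 : (if w.2.1.choose_spec.choose = (Quot.out (x w.2.1.choose).1).1 then (0 : Fin 2)
        else 1) = (if w'.2.1.choose_spec.choose = (Quot.out (x w'.2.1.choose).1).1 then 0 else 1) :=
        congrArg Prod.snd h
      obtain ⟨hv, hw⟩ := w.2.1.choose_spec.choose_spec
      obtain ⟨hv', hw'⟩ := w'.2.1.choose_spec.choose_spec
      have hvv : w.2.1.choose_spec.choose = w'.2.1.choose_spec.choose := by
        generalize w.2.1.choose_spec.choose = a at *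
        generalize w'.2.1.choose_spec.choose = b at *
        rw [← hi] at hv' h2
        generalize (x w.2.1.choose).1 = e at *
        rw [← Quot.out_eq e] at hv hv'
        generalize Quot.out e = p at *
        obtain ⟨p, q⟩ := p
        have hv := Sym2.mem_iff.1 hv
        have hv' := Sym2.mem_iff.1 hv'
        grind
      rw [← hvv] at hw'
      exact Subtype.ext (hR3 _ hw hw' (w.2.2.trans w'.2.2.symm))
    have := Nat.card_le_card_of_injective f hf
    rw [Nat.card_coe_set_eq, Nat.card_eq_fintype_card, Fintype.card_prod, Fintype.card_fin] at this
    omega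
  · intro a ha
    have hmem : B.mkQ a ∈ Submodule.span (ZMod 2) (Set.range ((B.mkQ ∘ C) ∘ x)) := by
      rw [hsp']
      exact Submodule.mem_map_of_mem ha
    obtain ⟨c, hc⟩ := (Submodule.mem_span_range_iff_exists_fun _).1 hmem
    have : a - ∑ i, c i • C (x i) ∈ B := by
      rw [← Submodule.ker_mkQ B, LinearMap.mem_ker, map_sub, map_sum, sub_eq_zero, ← hc]
      simp
    obtain ⟨F, hF⟩ := this
    refine ⟨F, fun e he => ?_⟩
    rw [hF]
    simp [Finset.sum_apply, hCZ _ _ he]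

end Layering

/-! ### Embedding schemes of induced subgraphs -/

section Induced

variable {V : Type u} {G : SimpleGraph V}

/-- A dart of an induced subgraph as a dart of the whole graph. -/
abbrev inclDart (A : Set V) (d : (G.induce A).Dart) : G.Dart :=
  (Embedding.induce A).toHom.mapDart d

/-- An edge of an induced subgraph as an edge of the whole graph. -/
abbrev inclEdge (A : Set V) : (G.induce A).edgeSet ↪ G.edgeSet :=
  (Embedding.induce A).mapEdgeSet

theorem inclDart_injective (A : Set V) :
    Function.Injective (inclDart A : (G.induce A).Dart → G.Dart) := by
  intro d d' h
  have h1 : (d.fst : V) = d'.fst := congrArg (fun d : G.Dart => d.fst) h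
  have h2 : (d.snd : V) = d'.snd := congrArg (fun d : G.Dart => d.snd) h
  exact Dart.ext _ _ (Prod.ext (Subtype.ext h1) (Subtype.ext h2))

variable [Fintype V]

/-- Extension by zero maps cycles to cycles. -/
theorem extend_mem_cycleSpace (A : Set V) {a : (G.induce A).edgeSet → ZMod 2}
    (ha : a ∈ (G.induce A).cycleSpace) :
    Function.extend (inclEdge A) a 0 ∈ G.cycleSpace := by
  rw [cycleSpace, LinearMap.mem_ker]
  ext v
  rw [boundaryMap_apply]
  have h1 : ∑ e, G.incidenceTwo v e * Function.extend (inclEdge A) a 0 e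
      = ∑ e, G.incidenceTwo v (inclEdge A e) * a e := by
    symm
    refine Fintype.sum_of_injective _ (inclEdge A).injective _ _ ?_ ?_
    · intro e he
      rw [Function.extend_apply' _ _ _ (by simpa using he), Pi.zero_apply, mul_zero]
    · intro e
      rw [(inclEdge A).injective.extend_apply]
  rw [h1]
  have hmem : ∀ e : (G.induce A).edgeSet, v ∈ (inclEdge A e).1 ↔ ∃ h : v ∈ A, ⟨v, h⟩ ∈ e.1 := by
    intro e
    change v ∈ Sym2.map Subtype.val e.1 ↔ _
    rw [Sym2.mem_map]
    constructor
    · rintro ⟨w, hw, rfl⟩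
      exact ⟨w.2, hw⟩
    · rintro ⟨h, hw⟩
      exact ⟨_, hw, rfl⟩
  by_cases hv : v ∈ A
  · have h2 := congrFun (LinearMap.mem_ker.1 ha) ⟨v, hv⟩
    rw [boundaryMap_apply] at h2
    refine Eq.trans (Finset.sum_congr rfl fun e _ => ?_) h2
    have hiff : v ∈ (inclEdge A e).1 ↔ ⟨v, hv⟩ ∈ e.1 := by simp only [hmem, hv, exists_true_left]
    congr 1
    simp only [incidenceTwo]
    by_cases h : ⟨v, hv⟩ ∈ e.1
    · rw [if_pos h, if_pos (hiff.2 h)]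
    · rw [if_neg h, if_neg (mt hiff.1 h)]
  · refine Finset.sum_eq_zero fun e _ => ?_
    have hnot : v ∉ (inclEdge A e).1 := fun h => hv ((hmem e).1 h).1
    simp only [incidenceTwo, if_neg hnot, zero_mul]

/-- If every cycle of `G` agrees with the boundary of a set of faces on the edges that have an
end in `A`, then `G.induce A` is planar. The embedding scheme of `G.induce A` arises by deletion
of darts. Given a cycle of `G.induce A`, the set of faces that it bounds on `A` does not change
across the edges that leave `A`, so that it is a set of faces of the scheme of `G.induce A`. -/
theorem EmbeddingScheme.planar_induce (S : G.EmbeddingScheme) (A : Set V)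
    (h : ∀ a ∈ G.cycleSpace, ∃ F : S.FacialWalk → ZMod 2,
      ∀ e, (∃ w ∈ e.1, w ∈ A) → a e = S.faceBoundary F e) :
    (G.induce A).Planar := by
  obtain ⟨τ, hτ, hcyc⟩ := S.rot.exists_firstReturn (inclDart A) (inclDart_injective A)
  have hfst : ∀ (n : ℕ) (d : G.Dart), ((S.rot ^ n) d).fst = d.fst := by
    intro n
    induction n with
    | zero => intro d; rfl
    | succ n ih => intro d; rw [pow_succ', Equiv.Perm.mul_apply, S.rot_fst, ih]
  let S' : (G.induce A).EmbeddingScheme :=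
    { rot := τ
      rot_fst := by
        intro d
        obtain ⟨n, hn, -⟩ := hτ d
        have := congrArg (fun d : G.Dart => d.fst) hn
        exact Subtype.ext (this.trans (hfst _ _))
      rot_sameCycle := fun d d' hd => hcyc d d'
        (S.rot_sameCycle _ _ (congrArg Subtype.val hd))
      sign := fun e => S.sign (inclEdge A e) }
  refine ⟨S', ?_⟩
  have hle : (G.induce A).cycleSpace ≤ LinearMap.range S'.faceBoundary := by
    intro a ha
    obtain ⟨F, hF⟩ := h _ (extend_mem_cycleSpace A ha)
    -- the two sides of an edge that leaves `A` are alike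
    have hleave : ∀ d : G.Dart, d.fst ∈ A → d ∉ Set.range (inclDart A) →
        F (Quot.mk _ (d, 1)) = F (Quot.mk _ (d, -1)) := by
      intro d hd hr
      have h1 := hF ⟨d.edge, d.edge_mem⟩ ⟨d.fst, Sym2.mem_mk_left _ _, hd⟩
      rw [Function.extend_apply', faceBoundary_apply] at h1
      · exact zmod_two_add_eq_zero_iff.1 h1.symm
      · rintro ⟨e, he⟩
        obtain ⟨d', rfl⟩ : ∃ d' : (G.induce A).Dart, e = ⟨d'.edge, d'.edge_mem⟩ :=
          ⟨_, Subtype.ext (exists_dart_edge_eq e).choose_spec.symm⟩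
        have he' : (inclDart A d').edge = d.edge := congrArg Subtype.val he
        rcases (dart_edge_eq_iff _ _).1 he' with h2 | h2
        · exact hr ⟨d', h2⟩
        · refine hr ⟨d'.symm, ?_⟩
          rw [← Dart.symm_symm d, ← h2]
          rfl
    have hcorner : ∀ d : (G.induce A).Dart,
        F (Quot.mk _ (inclDart A (τ d), -1)) = F (Quot.mk _ (inclDart A d, 1)) := by
      intro d
      obtain ⟨n, hn, hn'⟩ := hτ d
      rw [hn]
      clear hn
      induction n with
      | zero => exact S.corner_eq F _
      | succ n ih =>
        refine Eq.trans ?_ (ih fun i hi => hn' i (by omega))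
        refine Eq.trans ?_ (hleave _ ?_ (hn' n (by omega)))
        · rw [pow_succ' _ (n + 1)]
          exact S.corner_eq F _
        · rw [hfst]
          exact d.fst.2
    let F' : S'.FacialWalk → ZMod 2 :=
      Quot.lift (fun x => F (Quot.mk _ (inclDart A x.1, x.2))) (by
        rintro _ _ (d | ⟨d, s⟩)
        · exact (hcorner d).symm
        · exact congrArg F (Quot.sound (FaceStep.edge (S := S) (inclDart A d) s)))
    refine ⟨F', ?_⟩
    ext e
    obtain ⟨d, hd⟩ := exists_dart_edge_eq e
    obtain rfl : e = ⟨d.edge, d.edge_mem⟩ := Subtype.ext hd.symm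
    rw [faceBoundary_apply, ← (inclEdge A).injective.extend_apply a 0]
    refine Eq.trans ?_ (hF _ ⟨d.fst, ?_, d.fst.2⟩).symm
    · exact (S.faceBoundary_apply F (inclDart A d)).symm
    · exact Sym2.mem_mk_left _ _
  have h1 := S'.eulerGenus_add_finrank_range
  rw [le_antisymm S'.range_faceBoundary_le hle] at h1
  omega

end Induced

/-! ### Queue layouts -/

section Layout

variable {V : Type u} {G : SimpleGraph V}

/-- Queue layouts in terms of a numbering of the vertices, and of a numbering of the queues that
is defined on all pairs of vertices. -/
theorem HasQueueLayout.exists_numbering [Finite V] {k : ℕ} (h : G.HasQueueLayout k) :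
    ∃ (r : V → ℕ) (q : V → V → ℕ), Function.Injective r ∧ (∀ v w, q v w = q w v) ∧
      (∀ v w, G.Adj v w → q v w < k) ∧
      ∀ v w x y, G.Adj v w → G.Adj x y → r v < r x → r x < r y → r y < r w → q v w ≠ q x y := by
  obtain ⟨L, queue, hq⟩ := h
  have := Fintype.ofFinite V
  let o := (Fintype.orderIsoFinOfCardEq V rfl).symm
  refine ⟨fun v => o v, fun v w => if h : G.Adj v w then queue ⟨s(v, w), h⟩ else 0, ?_, ?_, ?_, ?_⟩
  · intro v w h
    exact o.injective (Fin.ext h)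
  · intro v w
    simp only [G.adj_comm w v, Sym2.eq_swap (a := w)]
  · intro v w h
    simp [h]
  · intro v w x y hvw hxy h1 h2 h3 h
    simp only [hvw, hxy, dif_pos] at h
    exact hq v w x y hvw hxy (o.lt_iff_lt.1 h1) (o.lt_iff_lt.1 h2) (o.lt_iff_lt.1 h3) (Fin.ext h)

/-- A queue layout from an injective key that orders the vertices. The queue of an edge is `q v w`
where `v` is its first end and `w` its second, so that `q` need not be symmetric. -/
theorem hasQueueLayout_of_key {α : Type*} [LinearOrder α] {k : ℕ} (key : V → α)
    (hkey : Function.Injective key) (q : V → V → ℕ)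
    (hq : ∀ v w, G.Adj v w → key v < key w → q v w < k)
    (h : ∀ v w x y, G.Adj v w → G.Adj x y → key v < key x → key x < key y → key y < key w →
      q v w ≠ q x y) :
    G.HasQueueLayout k := by
  let L : LinearOrder V := LinearOrder.lift' key hkey
  have hlt : ∀ {v w : V}, v < w ↔ key v < key w := Iff.rfl
  have hord : ∀ e : G.edgeSet, G.Adj e.1.inf e.1.sup ∧ e.1.inf < e.1.sup := by
    rintro ⟨e, he⟩
    induction e with
    | _ u v =>
      have he : G.Adj u v := he
      rcases lt_or_gt_of_ne he.ne with huv | huv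
      · simpa [huv.le, huv] using he
      · simpa [huv.le, huv] using he.symm
  refine ⟨L, fun e => ⟨q e.1.inf e.1.sup, hq _ _ (hord e).1 (hord e).2⟩, ?_⟩
  intro v w x y hvw hxy h1 h2 h3 heq
  have h4 : v < w := h1.trans (h2.trans h3)
  have := congrArg Fin.val heq
  simp only [Sym2.inf_mk, Sym2.sup_mk, inf_eq_left.2 h4.le, sup_eq_right.2 h4.le,
    inf_eq_left.2 h2.le, sup_eq_right.2 h2.le] at this
  exact h v w x y hvw hxy h1 h2 h3 this

theorem HasQueueLayout.mono {k l : ℕ} (h : G.HasQueueLayout k) (hkl : k ≤ l) :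
    G.HasQueueLayout l := by
  obtain ⟨L, queue, hq⟩ := h
  exact ⟨L, fun e => Fin.castLE hkl (queue e), fun v w x y hvw hxy h1 h2 h3 h4 =>
    hq v w x y hvw hxy h1 h2 h3 (Fin.castLE_injective hkl h4)⟩

theorem hasQueueLayout_queueNumber [Finite V] : G.HasQueueLayout G.queueNumber :=
  Nat.sInf_mem G.exists_hasQueueLayout

/-- Layer by layer, the vertices of `Z` are placed first, and then the others as in the given
layout of `G - Z`. An edge of `G - Z` that was in queue `q` gets one of the queues
`3 q`, `3 q + 1`, `3 q + 2`, according to whether it stays in a layer, or goes up a layer and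
agrees or disagrees with the given order. An edge that meets `Z` is assigned to its first end if
that lies in `Z`, and to its second end otherwise. If it is assigned to the `j`-th vertex of `Z` in
some layer, then it gets the queue `3 k + 2 j` if it goes up a layer from this vertex, and
`3 k + 2 j + 1` if it stays in the layer or goes down. -/
theorem hasQueueLayout_of_layering [Finite V] {k t : ℕ} (L : G.BFSLayering) (Z : Set V)
    (hZ : ∀ n, {v ∈ Z | L.layer v = n}.ncard ≤ t) (h : (G.induce Zᶜ).HasQueueLayout k) :
    G.HasQueueLayout (3 * k + 2 * t) := by
  obtain ⟨r, q, hr, hqs, hqk, hq⟩ := h.exists_numbering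
  have hj : ∃ j : V → ℕ, (∀ v ∈ Z, j v < t) ∧
      ∀ v ∈ Z, ∀ w ∈ Z, L.layer v = L.layer w → j v = j w → v = w := by
    have h1 : ∀ n, ∃ f : {v ∈ Z | L.layer v = n} → Fin t, Function.Injective f := by
      intro n
      have := Fintype.ofFinite {v ∈ Z | L.layer v = n}
      have h2 := hZ n
      rw [← Nat.card_coe_set_eq, Nat.card_eq_fintype_card] at h2
      obtain ⟨f⟩ := Function.Embedding.nonempty_of_card_le (α := {v ∈ Z | L.layer v = n})
        (β := Fin t) (by simpa using h2)
      exact ⟨f, f.injective⟩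
    choose f hf using h1
    refine ⟨fun v => if h : v ∈ Z then f (L.layer v) ⟨v, h, rfl⟩ else 0, ?_, ?_⟩
    · intro v hv
      simp [hv]
    · intro v hv w hw hl h2
      simp only [hv, hw, dif_pos] at h2
      have h3 : ∀ n (hn : L.layer w = n), (f n ⟨w, hw, hn⟩ : ℕ) = f (L.layer w) ⟨w, hw, rfl⟩ := by
        rintro _ rfl
        rfl
      rw [← h3 _ hl.symm] at h2
      exact congrArg Subtype.val (hf _ (Fin.ext h2))
  obtain ⟨j, hjt, hjinj⟩ := hj
  let pos : V → ℕ := fun v => if h : v ∈ Z then j v else t + r ⟨v, h⟩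
  have hposZ : ∀ v, v ∈ Z → pos v = j v := fun v hv => by simp [pos, hv]
  have hposN : ∀ v (hv : v ∉ Z), pos v = t + r ⟨v, hv⟩ := fun v hv => by simp [pos, hv]
  let key : V → ℕ ×ₗ ℕ := fun v => toLex (L.layer v, pos v)
  have hlt : ∀ v w, key v < key w ↔ L.layer v < L.layer w ∨
      L.layer v = L.layer w ∧ pos v < pos w := fun v w => Prod.Lex.lt_iff
  have hkey : Function.Injective key := by
    intro v w hvw
    have h1 : L.layer v = L.layer w := congrArg (fun x => (ofLex x).1) hvw
    have h2 : pos v = pos w := congrArg (fun x => (ofLex x).2) hvw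
    by_cases hv : v ∈ Z <;> by_cases hw : w ∈ Z
    · rw [hposZ v hv, hposZ w hw] at h2
      exact hjinj v hv w hw h1 h2
    · rw [hposZ v hv, hposN w hw] at h2
      have := hjt v hv
      omega
    · rw [hposN v hv, hposZ w hw] at h2
      have := hjt w hw
      omega
    · rw [hposN v hv, hposN w hw] at h2
      exact congrArg Subtype.val (hr (Nat.add_left_cancel h2))
  let lab : V → V → ℕ := fun v w =>
    if hv : v ∈ Z then 3 * k + 2 * j v + (if L.layer v = L.layer w then 1 else 0)
    else if hw : w ∈ Z then 3 * k + 2 * j w + 1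
    else 3 * q ⟨v, hv⟩ ⟨w, hw⟩ +
      (if L.layer v = L.layer w then 0 else if pos v < pos w then 1 else 2)
  refine hasQueueLayout_of_key key hkey lab ?_ ?_
  · intro v w hvw _
    simp only [lab]
    by_cases hv : v ∈ Z
    · have := hjt v hv
      rw [dif_pos hv]
      split_ifs <;> omega
    · by_cases hw : w ∈ Z
      · have := hjt w hw
        rw [dif_neg hv, dif_pos hw]
        omega
      · have := hqk ⟨v, hv⟩ ⟨w, hw⟩ hvw
        rw [dif_neg hv, dif_neg hw]
        split_ifs <;> omega
  · intro v w x y hvw hxy h1 h2 h3 hlab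
    have hne1 : x ≠ v := by rintro rfl; exact lt_irrefl _ h1
    have hne2 : y ≠ w := by rintro rfl; exact lt_irrefl _ h3
    have hne3 : x ≠ w := by rintro rfl; exact lt_irrefl _ (h2.trans h3)
    rw [hlt] at h1 h2 h3
    have hl1 := L.layer_le hvw
    have hl2 := L.layer_le hxy
    simp only [lab] at hlab
    -- nested edges of the same queue that meet `Z` would be assigned to vertices with the same
    -- place in the same layer, hence would share an end
    have hinj : ∀ a ∈ Z, ∀ b ∈ Z, a ≠ b → L.layer a = L.layer b → j a ≠ j b :=
      fun a ha b hb hne hl hj => hne (hjinj a ha b hb hl hj)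
    by_cases hv : v ∈ Z
    · rw [dif_pos hv] at hlab
      have hpv := hposZ v hv
      by_cases hx : x ∈ Z
      · rw [dif_pos hx] at hlab
        have := hinj x hx v hv hne1
        split_ifs at hlab <;> omega
      · rw [dif_neg hx] at hlab
        by_cases hy : y ∈ Z
        · rw [dif_pos hy] at hlab
          have := hposN x hx
          have := hposZ y hy
          have := hjt y hy
          split_ifs at hlab <;> omega
        · rw [dif_neg hy] at hlab
          have := hqk ⟨x, hx⟩ ⟨y, hy⟩ hxy
          split_ifs at hlab <;> omega
    · rw [dif_neg hv] at hlab
      have hpv := hposN v hv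
      by_cases hw : w ∈ Z
      · rw [dif_pos hw] at hlab
        have hpw := hposZ w hw
        have := hjt w hw
        by_cases hx : x ∈ Z
        · rw [dif_pos hx] at hlab
          have := hposZ x hx
          have := hjt x hx
          have := hinj x hx w hw hne3
          split_ifs at hlab <;> omega
        · rw [dif_neg hx] at hlab
          have := hposN x hx
          by_cases hy : y ∈ Z
          · rw [dif_pos hy] at hlab
            have := hposZ y hy
            have := hjt y hy
            have := hinj y hy w hw hne2
            omega
          · rw [dif_neg hy] at hlab
            have := hqk ⟨x, hx⟩ ⟨y, hy⟩ hxy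
            split_ifs at hlab <;> omega
      · rw [dif_neg hw] at hlab
        have hpw := hposN w hw
        have := hqk ⟨v, hv⟩ ⟨w, hw⟩ hvw
        by_cases hx : x ∈ Z
        · rw [dif_pos hx] at hlab
          split_ifs at hlab <;> omega
        · rw [dif_neg hx] at hlab
          by_cases hy : y ∈ Z
          · rw [dif_pos hy] at hlab
            split_ifs at hlab <;> omega
          · rw [dif_neg hy] at hlab
            have hpx := hposN x hx
            have hpy := hposN y hy
            have hvw' : (G.induce Zᶜ).Adj ⟨v, hv⟩ ⟨w, hw⟩ := hvw
            have hxy' : (G.induce Zᶜ).Adj ⟨x, hx⟩ ⟨y, hy⟩ := hxy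
            -- the pair is nested in the given layout of `G - Z`, with the roles of the outer and the
            -- inner edge exchanged if the two edges go up a layer and against the given order
            have hup := hq _ _ _ _ hvw' hxy'
            have hdown := hq _ _ _ _ hxy'.symm hvw'.symm
            rw [hqs ⟨y, hy⟩, hqs ⟨w, hw⟩] at hdown
            have hrne : r ⟨v, hv⟩ ≠ r ⟨w, hw⟩ := hr.ne hvw'.ne
            split_ifs at hlab <;> omega

end Layout

end
end SimpleGraph

theorem theorem4 (𝒢 : GraphClass.{u}) (h𝒢 : 𝒢.Hereditary) (k : ℕ)
    (hk : ∀ (V : Type u) [Finite V] (G : SimpleGraph V), 𝒢 V G → G.Planar → G.queueNumber ≤ k)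
    (V : Type u) [Finite V] (G : SimpleGraph V) (hG : 𝒢 V G) (g : ℕ) (hg : G.eulerGenus = g) :
    G.queueNumber ≤ 3 * k + 4 * g := by
  have := Fintype.ofFinite V
  obtain ⟨S, hS⟩ : ∃ S : G.EmbeddingScheme, S.eulerGenus.toNat = G.eulerGenus :=
    Nat.sInf_mem (Set.range_nonempty _)
  obtain ⟨L⟩ := G.nonempty_bfsLayering
  obtain ⟨Z, hZ, hcycle⟩ := S.exists_layered_generators L
  have hplanar : (G.induce Zᶜ).Planar := S.planar_induce Zᶜ hcycle
  have hlayout : (G.induce Zᶜ).HasQueueLayout k :=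
    SimpleGraph.hasQueueLayout_queueNumber.mono (hk _ _ (h𝒢 V G hG Zᶜ) hplanar)
  rw [hS, hg] at hZ
  refine Nat.sInf_le ?_
  have := SimpleGraph.hasQueueLayout_of_layering L Z hZ hlayout
  rwa [← mul_assoc] at this
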